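/- For $\alpha>0$ let $A_\alpha=(A_\alpha(i,j))_{i,j\in\mathbb Z}$ be the stochastic matrix with $A_\alpha(i,j)=c(\alpha)/|i-j|^{1+\alpha}$ for $i\neq j$ and $A_\alpha(i,i)=0$, where $c(\alpha)=\big(\sum_{k\in\mathbb Z\setminus\{0\}}|k|^{-1-\alpha}\big)^{-1}$ is the normalization constant, and let $A_\alpha^n$ denote its $n$-th matrix power. (i) For every $\alpha>0$, $$\sup_{i\in\mathbb Z}\sum_{j\in\mathbb Z}\big(A_\alpha^n(i,j)\big)^2\longrightarrow 0\qquad (n\to\infty).$$ (ii) Let $\alpha\in(0,2)$ and let $\mu=(\mu_j)_{j\in\mathbb Z}$ be a bounded sequence of non-negative real numbers for which the spatial average $$\bar\mu=\lim_{r\to\infty}\frac{1}{\#\{j\in\mathbb Z:|j|\le r\}}\sum_{|j|\le r}\mu_j$$ exists. Then, for every $i\in\mathbb Z$, $$(A_\alpha^n\mu)_i=\sum_{j\in\mathbb Z}A_\alpha^n(i,j)\,\mu_j\longrightarrow\bar\mu\qquad(n\to\infty).$$ -/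

import Mathlib

open Filter Topology

noncomputable section

/-- The normalization constant `c(α) = (∑_{k ∈ ℤ, k ≠ 0} |k|^{-(1+α)})⁻¹`. -/
def normConst (α : ℝ) : ℝ :=
  (∑' k : ℤ, if k = 0 then (0 : ℝ) else 1 / |(k : ℝ)| ^ (1 + α))⁻¹

/-- The matrix `A_α`, indexed by `ℤ × ℤ`, with entries `c(α) / |i - j|^{1+α}` off the diagonal and
`0` on the diagonal. -/
def longRange (α : ℝ) (i j : ℤ) : ℝ :=
  if i = j then 0 else normConst α / |(i : ℝ) - (j : ℝ)| ^ (1 + α)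

/-- The powers of a matrix indexed by `ℤ × ℤ` (each entry of a product is a series). -/
def matPow (A : ℤ → ℤ → ℝ) : ℕ → ℤ → ℤ → ℝ
  | 0 => fun i j => if i = j then 1 else 0
  | n + 1 => fun i j => ∑' k : ℤ, A i k * matPow A n k j

/-- The action of a matrix indexed by `ℤ × ℤ` on a sequence: `(A x)_i = ∑_j A(i,j) x_j`. -/
def matAct (A : ℤ → ℤ → ℝ) (x : ℤ → ℝ) (i : ℤ) : ℝ :=
  ∑' j : ℤ, A i j * x j

/-- `m` is the spatial average of `μ`: the limit, as `r → ∞`, of the mean of `μ` over the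
integers `i` with `|i| ≤ r`. -/
def IsSpatialAverage (μ : ℤ → ℝ) (m : ℝ) : Prop :=
  Tendsto (fun r : ℕ => (∑ i ∈ Finset.Icc (-(r : ℤ)) (r : ℤ), μ i) /
    ((Finset.Icc (-(r : ℤ)) (r : ℤ)).card : ℝ)) atTop (𝓝 m)

/-! The series in these definitions converge: `A_α` and its powers are stochastic matrices. -/

theorem summable_weights {α : ℝ} (hα : 0 < α) :
    Summable fun k : ℤ => if k = 0 then (0 : ℝ) else 1 / |(k : ℝ)| ^ (1 + α) := by
  have h := Real.summable_abs_int_rpow (b := 1 + α) (by linarith)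
  refine h.of_nonneg_of_le (fun k => ?_) (fun k => ?_)
  · split_ifs <;> positivity
  · split_ifs with hk
    · positivity
    · rw [Real.rpow_neg (abs_nonneg _), one_div]

theorem normConst_pos {α : ℝ} (hα : 0 < α) : 0 < normConst α := by
  refine inv_pos.2 ((summable_weights hα).tsum_pos (fun k => ?_) 1 (by simp))
  split_ifs <;> positivity

theorem longRange_nonneg {α : ℝ} (hα : 0 < α) (i j : ℤ) : 0 ≤ longRange α i j := by
  have := normConst_pos hα
  unfold longRange
  split_ifs <;> positivity

theorem hasSum_longRange {α : ℝ} (hα : 0 < α) (i : ℤ) : HasSum (longRange α i) 1 := by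
  have h := ((summable_weights hα).hasSum.mul_left (normConst α))
  have h1 : normConst α * (∑' k : ℤ, if k = 0 then (0 : ℝ) else 1 / |(k : ℝ)| ^ (1 + α)) = 1 := by
    have := (normConst_pos hα).ne'
    unfold normConst at this ⊢
    exact inv_mul_cancel₀ fun h0 => this (inv_eq_zero.2 h0)
  rw [h1] at h
  refine ((Equiv.subLeft i).hasSum_iff.2 h).congr_fun ?_
  intro j
  by_cases hij : i = j
  · simp [longRange, hij]
  · simp [longRange, hij, sub_eq_zero, div_eq_mul_inv]

theorem matPow_nonneg {A : ℤ → ℤ → ℝ} (h0 : ∀ i j, 0 ≤ A i j) (n : ℕ) (i j : ℤ) :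
    0 ≤ matPow A n i j := by
  induction n generalizing i with
  | zero => simp only [matPow]; split_ifs <;> simp
  | succ n ih => exact tsum_nonneg fun k => mul_nonneg (h0 i k) (ih k)

theorem hasSum_mul_stochastic {a : ℤ → ℝ} {P : ℤ → ℤ → ℝ} (a0 : ∀ k, 0 ≤ a k)
    (a1 : HasSum a 1) (P0 : ∀ k j, 0 ≤ P k j) (P1 : ∀ k, HasSum (P k) 1) :
    HasSum (fun j => ∑' k : ℤ, a k * P k j) 1 := by
  have hs : Summable (fun p : ℤ × ℤ => a p.1 * P p.1 p.2) := by
    rw [summable_prod_of_nonneg (fun p => mul_nonneg (a0 p.1) (P0 p.1 p.2))]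
    refine ⟨fun k => (P1 k).summable.mul_left (a k), ?_⟩
    have : (fun k => ∑' j : ℤ, a k * P k j) = a := by
      funext k
      rw [tsum_mul_left, (P1 k).tsum_eq, mul_one]
    simpa only [this] using a1.summable
  have h1 : HasSum (fun p : ℤ × ℤ => a p.1 * P p.1 p.2) 1 := by
    have h2 := hs.hasSum.prod_fiberwise fun k => (P1 k).mul_left (a k)
    simp only [mul_one] at h2
    exact h2.unique a1 ▸ hs.hasSum
  have hw : HasSum (fun q : ℤ × ℤ => a q.2 * P q.2 q.1) 1 :=
    (Equiv.prodComm ℤ ℤ).hasSum_iff.2 h1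
  exact hw.prod_fiberwise fun j => (hw.summable.prod_factor j).hasSum

theorem hasSum_matPow {A : ℤ → ℤ → ℝ} (h0 : ∀ i j, 0 ≤ A i j) (h1 : ∀ i, HasSum (A i) 1)
    (n : ℕ) (i : ℤ) : HasSum (matPow A n i) 1 := by
  induction n generalizing i with
  | zero => simpa [matPow, eq_comm] using hasSum_ite_eq i (1 : ℝ)
  | succ n ih => exact hasSum_mul_stochastic (h0 i) (h1 i) (matPow_nonneg h0 n) ih

theorem summable_matPow_mul {A : ℤ → ℤ → ℝ} (h0 : ∀ i j, 0 ≤ A i j) (h1 : ∀ i, HasSum (A i) 1)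
    (n : ℕ) (i j : ℤ) : Summable fun k => A i k * matPow A n k j := by
  refine (h1 i).summable.of_nonneg_of_le
    (fun k => mul_nonneg (h0 _ _) (matPow_nonneg h0 n _ _)) fun k => ?_
  exact mul_le_of_le_one_right (h0 _ _)
    (le_hasSum (hasSum_matPow h0 h1 n k) j fun l _ => matPow_nonneg h0 n k l)

end

open scoped BoundedContinuousFunction

noncomputable section

/-! Write $A$ for the matrix, acting as a contraction on bounded sequences, and $L=(1+A)/2$. The row
of $L$ at $0$ is symmetric and decreasing in $|j|$, while that of $A$ is not, its diagonal being
$0$. Convolution preserves this shape (`IsSymmDecreasing.conv`), so $x_n=L^n(0,0)$ is the largest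
entry of $L^n$ and controls the variation of its rows. The heavy tail forces $x_{n+1}\le
x_n-Cx_n^{1+\alpha}$, hence $x_n=O(n^{-1/\alpha})$ (`matPow_lazy_longRange_le_rpow`).

To return to $A$, write $A^2=aL+bQ$ with $a,b>0$, $a+b=1$ and $Q$ a stochastic matrix commuting with
$L$ (`exists_sq_op_longRange_eq`). Then $A^{2m}$ is a binomial average of the $L^kQ^{m-k}$, so
polynomial decay of $L^kv$ passes to $A^nv$ (`norm_pow_apply_le_of_sq_eq`). Applied to basis
sequences this bounds all entries of $A^n$ uniformly. As rows sum to $1$, (i) follows.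

For (ii), $L^n\mu$ converges to the spatial average for every $\alpha>0$ by Abel summation against
decreasing weights (`tendsto_lazy_op_pow_apply`). Moreover $A-L^2=-\frac14(1-A)^2$, and $L^n(1-A)$
and $A^n(1-A)$ have norm $O(n^{-\beta})$ with some $\beta>1/2$ once $\alpha<2$. Telescoping gives
$\|A^n-L^{2n}\|\to0$ (`tendsto_norm_pow_sub_lazy_pow`). -/

/-! ### Stochastic matrices as contractions of bounded sequences. -/

/-- A matrix indexed by `ℤ × ℤ` with non-negative entries and rows summing to `1`. -/
structure IsStochastic (A : ℤ → ℤ → ℝ) : Prop where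
  nonneg : ∀ i j, 0 ≤ A i j
  hasSum : ∀ i, HasSum (A i) 1

namespace IsStochastic

variable {A B : ℤ → ℤ → ℝ}

theorem pow (hA : IsStochastic A) (n : ℕ) : IsStochastic (matPow A n) :=
  ⟨matPow_nonneg hA.nonneg n, hasSum_matPow hA.nonneg hA.hasSum n⟩

theorem le_one (hA : IsStochastic A) (i j : ℤ) : A i j ≤ 1 :=
  le_hasSum (hA.hasSum i) j fun l _ => hA.nonneg i l

theorem norm_mul_le (hA : IsStochastic A) (f : ℤ →ᵇ ℝ) (i j : ℤ) :
    ‖A i j * f j‖ ≤ A i j * ‖f‖ := by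
  rw [norm_mul, Real.norm_of_nonneg (hA.nonneg i j)]
  exact mul_le_mul_of_nonneg_left (f.norm_coe_le_norm j) (hA.nonneg i j)

theorem summable_mul (hA : IsStochastic A) (f : ℤ →ᵇ ℝ) (i : ℤ) :
    Summable fun j => A i j * f j :=
  Summable.of_norm_bounded ((hA.hasSum i).summable.mul_right ‖f‖) (hA.norm_mul_le f i)

theorem norm_matAct_le (hA : IsStochastic A) (f : ℤ →ᵇ ℝ) (i : ℤ) : ‖matAct A f i‖ ≤ ‖f‖ := by
  have h := (hA.hasSum i).mul_right ‖f‖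
  rw [one_mul] at h
  exact tsum_of_norm_bounded h (hA.norm_mul_le f i)

/-- The operator on bounded sequences given by a stochastic matrix. -/
def op (hA : IsStochastic A) : (ℤ →ᵇ ℝ) →L[ℝ] (ℤ →ᵇ ℝ) :=
  LinearMap.mkContinuous
    { toFun := fun f =>
        BoundedContinuousFunction.ofNormedAddCommGroupDiscrete (matAct A f) ‖f‖
          (hA.norm_matAct_le f)
      map_add' := fun f g => by
        ext i
        simp only [BoundedContinuousFunction.coe_ofNormedAddCommGroupDiscrete, matAct,
          BoundedContinuousFunction.coe_add, Pi.add_apply, mul_add]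
        exact (hA.summable_mul f i).tsum_add (hA.summable_mul g i)
      map_smul' := fun c f => by
        ext i
        simp only [BoundedContinuousFunction.coe_ofNormedAddCommGroupDiscrete, matAct,
          BoundedContinuousFunction.coe_smul, smul_eq_mul, RingHom.id_apply]
        rw [← tsum_mul_left]
        exact tsum_congr fun j => by ring }
    1 fun f => by
      rw [one_mul]
      exact (BoundedContinuousFunction.norm_le (norm_nonneg f)).2 (hA.norm_matAct_le f)

theorem op_apply (hA : IsStochastic A) (f : ℤ →ᵇ ℝ) (i : ℤ) :
    hA.op f i = ∑' j, A i j * f j := rfl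

theorem norm_op_le (hA : IsStochastic A) : ‖hA.op‖ ≤ 1 :=
  LinearMap.mkContinuous_norm_le _ zero_le_one _

theorem hasSum_op (hA : IsStochastic A) (f : ℤ →ᵇ ℝ) (i : ℤ) :
    HasSum (fun j => A i j * f j) (hA.op f i) := (hA.summable_mul f i).hasSum

theorem op_op_apply (hA : IsStochastic A) (hB : IsStochastic B) (f : ℤ →ᵇ ℝ) (i : ℤ) :
    hA.op (hB.op f) i = ∑' j, (∑' k, A i k * B k j) * f j := by
  have hs : Summable (fun p : ℤ × ℤ => A i p.1 * B p.1 p.2) := by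
    rw [summable_prod_of_nonneg
      (fun p : ℤ × ℤ => mul_nonneg (hA.nonneg i p.1) (hB.nonneg p.1 p.2))]
    refine ⟨fun k => (hB.hasSum k).summable.mul_left (A i k), ?_⟩
    have h : (fun k => ∑' j : ℤ, A i k * B k j) = A i := by
      funext k
      rw [tsum_mul_left, (hB.hasSum k).tsum_eq, mul_one]
    simpa only [h] using (hA.hasSum i).summable
  have hs' : Summable (fun p : ℤ × ℤ => A i p.1 * B p.1 p.2 * f p.2) := by
    refine Summable.of_norm_bounded (hs.mul_right ‖f‖) fun p => ?_
    rw [norm_mul, Real.norm_of_nonneg (mul_nonneg (hA.nonneg _ _) (hB.nonneg _ _))]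
    exact mul_le_mul_of_nonneg_left (f.norm_coe_le_norm _)
      (mul_nonneg (hA.nonneg _ _) (hB.nonneg _ _))
  have hc := Summable.tsum_comm (f := fun k j => A i k * B k j * f j) hs'
  simp only [op_apply, ← tsum_mul_left, ← tsum_mul_right, ← mul_assoc]
  exact hc.symm

theorem op_pow_apply (hA : IsStochastic A) (n : ℕ) (f : ℤ →ᵇ ℝ) (i : ℤ) :
    (hA.op ^ n) f i = ∑' j, matPow A n i j * f j := by
  suffices h : hA.op ^ n = (hA.pow n).op by rw [h]; rfl
  induction n with
  | zero =>
    ext f i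
    rw [op_apply, tsum_eq_single i fun j hj => by simp [matPow, hj.symm]]
    simp [matPow]
  | succ n ih =>
    ext f i
    rw [pow_succ', ih, mul_apply_eq_comp, op_op_apply]
    rfl

end IsStochastic

/-- The sequence with a single entry `1`, at `j`. -/
def basisSeq (j : ℤ) : ℤ →ᵇ ℝ :=
  BoundedContinuousFunction.ofNormedAddCommGroupDiscrete (fun i => if i = j then (1 : ℝ) else 0) 1
    fun i => by split_ifs <;> simp

theorem basisSeq_apply (i j : ℤ) : basisSeq j i = if i = j then 1 else 0 := rfl

theorem IsStochastic.op_pow_basisSeq {A : ℤ → ℤ → ℝ} (hA : IsStochastic A) (n : ℕ) (i j : ℤ) :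
    (hA.op ^ n) (basisSeq j) i = matPow A n i j := by
  rw [hA.op_pow_apply, tsum_eq_single j fun k hk => by simp [basisSeq_apply, hk]]
  simp [basisSeq_apply]

/-- The lazy version `(1 + A) / 2` of a matrix. -/
def lazy (A : ℤ → ℤ → ℝ) (i j : ℤ) : ℝ := ((if i = j then 1 else 0) + A i j) / 2

theorem IsStochastic.lazy {A : ℤ → ℤ → ℝ} (hA : IsStochastic A) : IsStochastic (lazy A) where
  nonneg i j := by
    have := hA.nonneg i j
    unfold _root_.lazy
    split_ifs <;> positivity
  hasSum i := by
    have h := ((hasSum_ite_eq i (1 : ℝ)).add (hA.hasSum i)).div_const 2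
    norm_num at h
    exact h.congr_fun fun j => by simp [_root_.lazy, eq_comm]

theorem IsStochastic.op_lazy {A : ℤ → ℤ → ℝ} (hA : IsStochastic A) :
    hA.lazy.op = (1 / 2 : ℝ) • (1 + hA.op) := by
  ext f i
  have h := ((hasSum_ite_eq i (f i)).add (hA.hasSum_op f i)).div_const 2
  refine ((h.congr_fun fun j => ?_).tsum_eq).trans ?_
  · by_cases hij : i = j
    · subst hij; simp [_root_.lazy]; ring
    · simp [_root_.lazy, hij, Ne.symm hij]; ring
  · simp; ring

theorem matPow_add_right {A : ℤ → ℤ → ℝ} (h : ∀ i j t, A (i + t) (j + t) = A i j) (n : ℕ)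
    (i j t : ℤ) : matPow A n (i + t) (j + t) = matPow A n i j := by
  induction n generalizing i j with
  | zero => simp [matPow]
  | succ n ih =>
    simp only [matPow]
    rw [← (Equiv.addRight t).tsum_eq]
    exact tsum_congr fun k => by simp [h, ih]

/-! ### Symmetric decreasing sequences. -/

/-- Symmetric sequences that decrease away from `0`. -/
structure IsSymmDecreasing (u : ℤ → ℝ) : Prop where
  neg : ∀ k, u (-k) = u k
  succ_le : ∀ k, 0 ≤ k → u (k + 1) ≤ u k

namespace IsSymmDecreasing

variable {u v : ℤ → ℝ}

theorem apply_abs (hu : IsSymmDecreasing u) (k : ℤ) : u |k| = u k := by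
  rcases abs_choice k with h | h <;> rw [h]
  exact hu.neg k

theorem le_of_abs_le (hu : IsSymmDecreasing u) {i j : ℤ} (h : |i| ≤ |j|) : u j ≤ u i := by
  rw [← hu.apply_abs i, ← hu.apply_abs j]
  have key : ∀ m : ℤ, |i| ≤ m → u m ≤ u |i| := fun m hm => by
    induction m, hm using Int.leInduction with
    | base => exact le_rfl
    | succ n hn ih => exact (hu.succ_le n ((abs_nonneg i).trans hn)).trans ih
  exact key _ h

theorem le_zero (hu : IsSymmDecreasing u) (j : ℤ) : u j ≤ u 0 := hu.le_of_abs_le (by simp)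

/-- The convolution of symmetric decreasing sequences is symmetric decreasing. -/
theorem conv (hu : IsSymmDecreasing u) (hv : IsSymmDecreasing v)
    (hs : ∀ i, Summable fun j => u j * v (i - j)) :
    IsSymmDecreasing fun i => ∑' j, u j * v (i - j) where
  neg i := by
    rw [← (Equiv.neg ℤ).tsum_eq]
    refine tsum_congr fun j => ?_
    rw [Equiv.neg_apply, hu.neg, ← hv.neg (-i - -j)]
    congr 2; ring
  succ_le i hi := by
    -- By symmetry of `v`, `d (-1 - m) = -d m`. Adding the sum over `m` to its reflection `m ↦ -1 -
    -- m` gives twice the wanted difference as a sum of `(u (i - m) - u (i + 1 + m)) * d m`, where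
    -- both factors have the sign of `m + 1/2`, in the weak sense.
    set d : ℤ → ℝ := fun m => v m - v (m + 1) with hd
    have h1 : HasSum (fun j => u j * d (i - j))
        ((∑' j, u j * v (i - j)) - ∑' j, u j * v (i + 1 - j)) := by
      refine ((hs i).hasSum.sub (hs (i + 1)).hasSum).congr_fun fun j => ?_
      rw [hd, ← mul_sub]; ring_nf
    have h2 : HasSum (fun m => u (i - m) * d m) _ :=
      ((Equiv.subLeft i).hasSum_iff.2 h1).congr_fun fun m => by simp
    have h3 : HasSum (fun m => u (i + 1 + m) * -d m) _ :=
      ((Equiv.subLeft (-1 : ℤ)).hasSum_iff.2 h2).congr_fun fun m => by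
        simp only [Function.comp, Equiv.subLeft_apply, hd]
        rw [← hv.neg (-1 - m), ← hv.neg (-1 - m + 1)]
        ring_nf
    have h4 := (h2.add h3).nonneg fun m => by
      have : u (i - m) * d m + u (i + 1 + m) * -d m = (u (i - m) - u (i + 1 + m)) * d m := by ring
      rw [this]
      rcases le_or_gt 0 m with hm | hm
      · refine mul_nonneg (sub_nonneg.2 (hu.le_of_abs_le ?_)) (sub_nonneg.2 (hv.succ_le m hm))
        rw [abs_le, abs_of_nonneg (by omega : 0 ≤ i + 1 + m)]
        omega
      · refine mul_nonneg_of_nonpos_of_nonpos (sub_nonpos.2 (hu.le_of_abs_le ?_))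
          (sub_nonpos.2 (hv.le_of_abs_le ?_))
        · rw [abs_le, abs_of_nonneg (by omega : 0 ≤ i - m)]
          omega
        · rw [abs_of_neg hm, abs_le]; omega
    linarith

/-- The increments telescope on each half-line, and each half contributes `u 0`. -/
theorem hasSum_abs_succ_sub (hu : IsSymmDecreasing u) (hs : Summable u) :
    HasSum (fun j => |u (j + 1) - u j|) (2 * u 0) := by
  have h0 : HasSum (fun n : ℕ => u n - u (n + 1)) (u 0) := by
    rw [hasSum_iff_tendsto_nat_of_nonneg fun n => sub_nonneg.2 (hu.succ_le n (by positivity))]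
    have ht : Tendsto (fun n : ℕ => u n) atTop (𝓝 0) :=
      (hs.comp_injective Nat.cast_injective).tendsto_atTop_zero
    have := ht.const_sub (u 0)
    rw [sub_zero] at this
    refine this.congr fun n => ?_
    have := Finset.sum_range_sub' (fun n : ℕ => u n) n
    push_cast at this
    exact this.symm
  rw [two_mul]
  refine HasSum.of_nat_of_neg_add_one (h0.congr_fun fun n => ?_) (h0.congr_fun fun n => ?_)
  · rw [abs_sub_comm, abs_of_nonneg (sub_nonneg.2 (hu.succ_le n (by positivity)))]
  · rw [← hu.neg (-(n + 1 : ℤ) + 1), ← hu.neg (-(n + 1 : ℤ))]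
    have h := hu.succ_le n (by positivity)
    rw [show -(-(n + 1 : ℤ) + 1) = n by ring, neg_neg, abs_of_nonneg (sub_nonneg.2 h)]

theorem tsum_abs_add_sub_le (hu : IsSymmDecreasing u) (hs : Summable u) (k : ℤ) :
    Summable (fun j => |u (j + k) - u j|) ∧ ∑' j, |u (j + k) - u j| ≤ 2 * |(k : ℝ)| * u 0 := by
  have shift (t : ℤ) : Summable fun j => u (j + t) := hs.comp_injective (add_left_injective t)
  have hsum (t : ℤ) : Summable fun j => |u (j + t) - u j| := ((shift t).sub hs).abs
  refine ⟨hsum k, ?_⟩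
  have hnat : ∀ n : ℕ, ∑' j, |u (j + n) - u j| ≤ 2 * n * u 0 := by
    intro n
    induction n with
    | zero => simp
    | succ n ih =>
      have h1 := (Equiv.addRight (n : ℤ)).hasSum_iff.2 (hu.hasSum_abs_succ_sub hs)
      have h2 := h1.add (hsum n).hasSum
      have h3 := (hsum (n + 1 : ℕ)).hasSum
      have := hasSum_le (fun j => ?_) h3 h2
      · push_cast at this ⊢; linarith
      · simp only [Function.comp, Equiv.coe_addRight]
        have := abs_sub_le (u (j + (n + 1 : ℕ))) (u (j + n)) (u j)
        push_cast at this ⊢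
        rwa [add_assoc j]
  obtain ⟨n, rfl | rfl⟩ := k.eq_nat_or_neg
  · simpa using hnat n
  · have : ∑' j, |u (j + -(n : ℤ)) - u j| = ∑' j, |u (j + n) - u j| := by
      rw [← (Equiv.addRight (n : ℤ)).tsum_eq]
      exact tsum_congr fun j => by simp [abs_sub_comm]
    rw [this]
    simpa using hnat n

/-- The `2|j| + 1` entries at distance at most `|j|` from `0` are all at least `u j`, and their
total is at most `1`. -/
theorem le_inv (hu : IsSymmDecreasing u) (h0 : ∀ k, 0 ≤ u k) (h1 : HasSum u 1) (j : ℤ) :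
    u j ≤ 1 / (2 * |(j : ℝ)| + 1) := by
  have h := sum_le_hasSum (Finset.Icc (-|j|) |j|) (fun k _ => h0 k) h1
  have h2 : (Finset.Icc (-|j|) |j|).card • u j ≤ ∑ k ∈ Finset.Icc (-|j|) |j|, u k := by
    refine Finset.card_nsmul_le_sum _ _ _ fun k hk => hu.le_of_abs_le ?_
    rw [Finset.mem_Icc] at hk
    exact abs_le.2 hk
  have h3 : ((Finset.Icc (-|j|) |j|).card : ℝ) = 2 * |(j : ℝ)| + 1 := by
    rw [Int.card_Icc]
    have : ((|j| + 1 - -|j|).toNat : ℤ) = 2 * |j| + 1 := by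
      have := abs_nonneg j
      omega
    rw [← Int.cast_natCast (R := ℝ), this]; simp
  rw [nsmul_eq_mul, h3] at h2
  rw [le_div_iff₀ (by positivity)]
  linarith

end IsSymmDecreasing

/-! ### Binomial averages and transfer of polynomial decay. -/

/-- The absorption identity turns the sum into the expansion of $(a+b)^{n+1}$ without its term
$b^{n+1}$. -/
theorem sum_binomial_mul_inv_le {a b : ℝ} (ha : 0 < a) (hb : 0 ≤ b) (hab : a + b = 1) (n : ℕ) :
    ∑ k ∈ Finset.range (n + 1), a ^ k * b ^ (n - k) * n.choose k * (1 / ((k : ℝ) + 1)) ≤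
      1 / (a * ((n : ℝ) + 1)) := by
  have h1 : ∑ k ∈ Finset.range (n + 1), a ^ k * b ^ (n - k) * n.choose k * (1 / ((k : ℝ) + 1)) =
      (∑ k ∈ Finset.range (n + 1), a ^ (k + 1) * b ^ (n + 1 - (k + 1)) * (n + 1).choose (k + 1)) /
        (a * ((n : ℝ) + 1)) := by
    rw [Finset.sum_div]
    refine Finset.sum_congr rfl fun k _ => ?_
    have h : ((n : ℝ) + 1) * n.choose k = (n + 1).choose (k + 1) * ((k : ℝ) + 1) := by
      exact_mod_cast Nat.add_one_mul_choose_eq n k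
    rw [Nat.add_sub_add_right, mul_one_div, div_eq_div_iff (by positivity) (by positivity),
      pow_succ]
    linear_combination a ^ k * b ^ (n - k) * a * h
  have h2 := add_pow a b (n + 1)
  rw [hab, one_pow, Finset.sum_range_succ'] at h2
  rw [h1]
  gcongr
  rw [h2, le_add_iff_nonneg_right]
  positivity

/-- Bernoulli's inequality for the concave power $t^\beta$ at $t=y/x$. It is the tangent bound in
$1/x$, which reduces exponents in $[0,1]$ to the inverse first moment. -/
theorem rpow_neg_le_linear {β x y : ℝ} (hβ : 0 ≤ β) (hβ' : β ≤ 1) (hx : 0 < x) (hy : 0 < y) :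
    x ^ (-β) ≤ y ^ (-β) * ((1 - β) + β * y * (1 / x)) := by
  have h := rpow_one_add_le_one_add_mul_self (s := y / x - 1)
    (by have : 0 < y / x := by positivity
        linarith) hβ hβ'
  rw [add_sub_cancel, Real.div_rpow hy.le hx.le] at h
  have hy' : 0 < y ^ β := by positivity
  rw [Real.rpow_neg hx.le, Real.rpow_neg hy.le, inv_mul_eq_div, le_div_iff₀ hy',
    inv_mul_eq_div]
  refine h.trans (le_of_eq ?_)
  ring

theorem sum_binomial_mul_rpow_le {a b β : ℝ} (ha : 0 < a) (hb : 0 ≤ b) (hab : a + b = 1)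
    (hβ : 0 ≤ β) (hβ' : β ≤ 1) (n : ℕ) :
    ∑ k ∈ Finset.range (n + 1), a ^ k * b ^ (n - k) * n.choose k * ((k : ℝ) + 1) ^ (-β) ≤
      1 / a * ((n : ℝ) + 1) ^ (-β) := by
  have hN : (0 : ℝ) < n + 1 := by positivity
  have h1 : ∑ k ∈ Finset.range (n + 1), a ^ k * b ^ (n - k) * n.choose k * ((k : ℝ) + 1) ^ (-β) ≤
      ∑ k ∈ Finset.range (n + 1), a ^ k * b ^ (n - k) * n.choose k *
        (((n : ℝ) + 1) ^ (-β) * ((1 - β) + β * ((n : ℝ) + 1) * (1 / ((k : ℝ) + 1)))) := by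
    gcongr with k hk
    exact rpow_neg_le_linear hβ hβ' (by positivity) hN
  have h2 : ∑ k ∈ Finset.range (n + 1), a ^ k * b ^ (n - k) * n.choose k *
        (((n : ℝ) + 1) ^ (-β) * ((1 - β) + β * ((n : ℝ) + 1) * (1 / ((k : ℝ) + 1)))) =
      ((n : ℝ) + 1) ^ (-β) * ((1 - β) * (a + b) ^ n + β * ((n : ℝ) + 1) *
        ∑ k ∈ Finset.range (n + 1), a ^ k * b ^ (n - k) * n.choose k * (1 / ((k : ℝ) + 1))) := by
    rw [add_pow, Finset.mul_sum, Finset.mul_sum, ← Finset.sum_add_distrib, Finset.mul_sum]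
    exact Finset.sum_congr rfl fun k _ => by ring
  have h3 : β * ((n : ℝ) + 1) *
      ∑ k ∈ Finset.range (n + 1), a ^ k * b ^ (n - k) * n.choose k * (1 / ((k : ℝ) + 1)) ≤
      β * (1 / a) :=
    (mul_le_mul_of_nonneg_left (sum_binomial_mul_inv_le ha hb hab n) (by positivity)).trans
      (le_of_eq (by field_simp))
  have h4 : 1 ≤ 1 / a := (one_le_div ha).2 (by linarith)
  rw [hab, one_pow, mul_one] at h2
  rw [h2] at h1
  refine h1.trans ?_
  rw [mul_comm (1 / a)]
  gcongr
  nlinarith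

theorem norm_pow_apply_le_of_sq_eq {V : Type*} [NormedAddCommGroup V] [NormedSpace ℝ V]
    {P L Q : V →L[ℝ] V} {a b β C : ℝ} (ha : 0 < a) (hb : 0 ≤ b) (hab : a + b = 1)
    (hP : ‖P‖ ≤ 1) (hQ : ‖Q‖ ≤ 1) (hLQ : Commute L Q) (h : P ^ 2 = a • L + b • Q)
    (hβ : 0 ≤ β) (hβ' : β ≤ 1) (v : V) (hv : ∀ k : ℕ, ‖(L ^ k) v‖ ≤ C * ((k : ℝ) + 1) ^ (-β))
    (n : ℕ) : ‖(P ^ n) v‖ ≤ 2 * C / a * ((n : ℝ) + 1) ^ (-β) := by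
  have contr {T : V →L[ℝ] V} (hT : ‖T‖ ≤ 1) (m : ℕ) (w : V) : ‖(T ^ m) w‖ ≤ ‖w‖ := by
    induction m with
    | zero => simp
    | succ m ih =>
      rw [pow_succ', mul_apply_eq_comp]
      have := T.le_of_opNorm_le hT ((T ^ m) w)
      linarith
  have hC : 0 ≤ C := by simpa using (norm_nonneg _).trans (hv 0)
  have heven : ∀ m : ℕ, ‖(P ^ (2 * m)) v‖ ≤ C / a * ((m : ℝ) + 1) ^ (-β) := by
    intro m
    have hc : Commute (a • L) (b • Q) := (hLQ.smul_left a).smul_right b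
    have hexp : (P ^ (2 * m)) v = ∑ k ∈ Finset.range (m + 1),
        (a ^ k * b ^ (m - k) * m.choose k) • (Q ^ (m - k)) ((L ^ k) v) := by
      rw [pow_mul, h, hc.add_pow, _root_.sum_apply]
      refine Finset.sum_congr rfl fun k _ => ?_
      rw [smul_pow, smul_pow, smul_mul_smul_comm, (hLQ.pow_pow _ _).eq, ← nsmul_eq_mul',
        ← Nat.cast_smul_eq_nsmul ℝ, smul_smul, _root_.smul_apply,
        mul_apply_eq_comp]
      congr 1; ring
    rw [hexp]
    refine (norm_sum_le _ _).trans ?_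
    have : ∀ k ∈ Finset.range (m + 1),
        ‖(a ^ k * b ^ (m - k) * m.choose k) • (Q ^ (m - k)) ((L ^ k) v)‖ ≤
        C * (a ^ k * b ^ (m - k) * m.choose k * ((k : ℝ) + 1) ^ (-β)) := fun k _ => by
      rw [norm_smul, Real.norm_of_nonneg (by positivity), mul_left_comm]
      gcongr
      exact (contr hQ _ _).trans (hv k)
    refine (Finset.sum_le_sum this).trans ?_
    rw [← Finset.mul_sum, div_eq_mul_one_div, mul_assoc]
    gcongr
    exact sum_binomial_mul_rpow_le ha hb hab hβ hβ' m
  have hn : ‖(P ^ n) v‖ ≤ ‖(P ^ (2 * (n / 2))) v‖ := by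
    conv_lhs => rw [← Nat.mod_add_div n 2, pow_add, mul_apply_eq_comp]
    exact contr hP _ _
  refine (hn.trans (heven (n / 2))).trans ?_
  have h2 : ((n : ℝ) + 1) / 2 ≤ ((n / 2 : ℕ) : ℝ) + 1 := by
    have : n + 1 ≤ 2 * (n / 2) + 2 := by omega
    have : (n : ℝ) + 1 ≤ 2 * ((n / 2 : ℕ) : ℝ) + 2 := by exact_mod_cast this
    linarith
  -- Halving the exponent `n` costs $2^\beta\le2$.
  have h3 : (((n / 2 : ℕ) : ℝ) + 1) ^ (-β) ≤ 2 * ((n : ℝ) + 1) ^ (-β) := by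
    refine (Real.rpow_le_rpow_of_nonpos (by positivity) h2 (by linarith)).trans ?_
    rw [Real.div_rpow (by positivity) zero_le_two, div_eq_mul_inv, mul_comm,
      Real.rpow_neg zero_le_two, inv_inv]
    gcongr
    exact (Real.rpow_le_rpow_of_exponent_le one_le_two hβ').trans (by simp)
  calc C / a * (((n / 2 : ℕ) : ℝ) + 1) ^ (-β) ≤ C / a * (2 * ((n : ℝ) + 1) ^ (-β)) := by gcongr
    _ = _ := by ring

/-! ### Two scalar estimates and the comparison of $P^n$ with $L^{2n}$. -/

/-- A discrete form of $x'=-Cx^{1+\alpha}$: the quantity $x_n^{-\alpha}$ grows by at least $C\alpha$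
at each step, because $1-t\le e^{-t}$ and $e^s\ge1+s$. -/
theorem le_rpow_of_succ_le_sub {x : ℕ → ℝ} {α C : ℝ} (hα : 0 < α) (hC : 0 < C)
    (h0 : ∀ n, 0 < x n) (h1 : x 0 ≤ 1)
    (h : ∀ n, x (n + 1) ≤ x n - C * x n ^ (1 + α)) :
    ∃ D, 0 < D ∧ ∀ n : ℕ, x n ≤ D * ((n : ℝ) + 1) ^ (-(1 / α)) := by
  set c := min 1 (C * α) with hc
  have hc0 : 0 < c := lt_min one_pos (by positivity)
  have key : ∀ n : ℕ, c * ((n : ℝ) + 1) ≤ x n ^ (-α) := by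
    intro n
    induction n with
    | zero =>
      have := Real.one_le_rpow_of_pos_of_le_one_of_nonpos (h0 0) h1 (neg_nonpos.2 hα.le)
      rw [Nat.cast_zero, zero_add, mul_one]
      exact (min_le_left 1 (C * α)).trans this
    | succ n ih =>
      have hx := h0 n
      have hle : x (n + 1) ≤ x n * Real.exp (-(C * x n ^ α)) := by
        refine (h n).trans ?_
        have := Real.add_one_le_exp (-(C * x n ^ α))
        rw [Real.rpow_add hx, Real.rpow_one]
        nlinarith
      have h2 := Real.rpow_le_rpow_of_nonpos (h0 (n + 1)) hle (neg_nonpos.2 hα.le)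
      rw [Real.mul_rpow hx.le (Real.exp_pos _).le, ← Real.exp_mul] at h2
      have h3 := Real.add_one_le_exp (-(C * x n ^ α) * -α)
      have h4 : x n ^ (-α) * x n ^ α = 1 := by
        rw [← Real.rpow_add hx, neg_add_cancel, Real.rpow_zero]
      have h5 : 0 < x n ^ (-α) := by positivity
      have h6 : x n ^ (-α) * (-(C * x n ^ α) * -α + 1) = C * α + x n ^ (-α) := by
        linear_combination C * α * h4
      have h7 := mul_le_mul_of_nonneg_left h3 h5.le
      have h8 := min_le_right 1 (C * α)
      push_cast
      linarith
  refine ⟨c ^ (-(1 / α)), by positivity, fun n => ?_⟩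
  have hx := h0 n
  rw [← Real.mul_rpow hc0.le (by positivity)]
  have := Real.rpow_le_rpow_of_nonpos (z := -(1 / α)) (by positivity) (key n)
    (by rw [neg_nonpos]; positivity)
  rwa [← Real.rpow_mul hx.le, neg_mul_neg, mul_one_div_cancel hα.ne', Real.rpow_one] at this

theorem tendsto_sum_mul_rpow_neg {β : ℝ} (hβ : 1 / 2 < β) :
    Tendsto (fun n : ℕ => ∑ i ∈ Finset.range n, (((i : ℝ) + 1) * ((n - 1 - i : ℕ) + 1)) ^ (-β))
      atTop (𝓝 0) := by
  -- Since $(i+1)(n-i)\ge n$, the power $\beta-\gamma$ yields a vanishing factor. The remaining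
  -- power $\gamma$ splits by AM-GM into two series, convergent because $2\gamma>1$.
  obtain ⟨γ, hγ, hγβ⟩ := exists_between hβ
  have hsum : Summable fun i : ℕ => ((i : ℝ) + 1) ^ (-(2 * γ)) := by
    have := (summable_nat_add_iff 1).2 (Real.summable_nat_rpow (p := -(2 * γ)) |>.2 (by linarith))
    simpa using this
  set S := ∑' i : ℕ, ((i : ℝ) + 1) ^ (-(2 * γ)) with hS
  have hlim : Tendsto (fun n : ℕ => (n : ℝ) ^ (-(β - γ)) * S) atTop (𝓝 0) := by
    simpa using ((tendsto_rpow_neg_atTop (sub_pos.2 hγβ)).comp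
      tendsto_natCast_atTop_atTop).mul_const S
  refine squeeze_zero (fun n => Finset.sum_nonneg fun i _ => by positivity) (fun n => ?_) hlim
  have hterm : ∀ i ∈ Finset.range n, (((i : ℝ) + 1) * ((n - 1 - i : ℕ) + 1)) ^ (-β) ≤
      (n : ℝ) ^ (-(β - γ)) *
        ((((i : ℝ) + 1) ^ (-(2 * γ)) + (((n - 1 - i : ℕ) : ℝ) + 1) ^ (-(2 * γ))) / 2) := by
    intro i hi
    rw [Finset.mem_range] at hi
    obtain ⟨m, rfl⟩ : ∃ m, n = i + 1 + m := ⟨n - (i + 1), by omega⟩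
    rw [show i + 1 + m - 1 - i = m by omega]
    have hi0 : (0 : ℝ) < i + 1 := by positivity
    have hm0 : (0 : ℝ) < m + 1 := by positivity
    have hsplit : (((i : ℝ) + 1) * (m + 1)) ^ (-β) =
        (((i : ℝ) + 1) * (m + 1)) ^ (-(β - γ)) * (((i : ℝ) + 1) * (m + 1)) ^ (-γ) := by
      rw [← Real.rpow_add (by positivity)]; ring_nf
    rw [hsplit]
    refine mul_le_mul ?_ ?_ (by positivity) (by positivity)
    · refine Real.rpow_le_rpow_of_nonpos (by push_cast; positivity) ?_ (by linarith)
      push_cast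
      nlinarith [mul_nonneg (Nat.cast_nonneg (α := ℝ) i) (Nat.cast_nonneg (α := ℝ) m)]
    · rw [Real.mul_rpow hi0.le hm0.le, show -(2 * γ) = -γ * 2 by ring, Real.rpow_mul hi0.le,
        Real.rpow_mul hm0.le, Real.rpow_two, Real.rpow_two]
      nlinarith [sq_nonneg (((i : ℝ) + 1) ^ (-γ) - ((m : ℝ) + 1) ^ (-γ))]
  refine (Finset.sum_le_sum hterm).trans ?_
  rw [← Finset.mul_sum, ← Finset.sum_div, Finset.sum_add_distrib,
    Finset.sum_range_reflect (fun i : ℕ => ((i : ℝ) + 1) ^ (-(2 * γ)))]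
  gcongr
  have := hsum.sum_le_tsum (Finset.range n) fun i _ => by positivity
  linarith

theorem tendsto_norm_pow_sub_lazy_pow {V : Type*} [NormedAddCommGroup V] [NormedSpace ℝ V]
    {P L : V →L[ℝ] V} {β D : ℝ} (hL : L = (1 / 2 : ℝ) • (1 + P)) (hβ : 1 / 2 < β)
    (hP : ∀ n : ℕ, ‖P ^ n * (1 - P)‖ ≤ D * ((n : ℝ) + 1) ^ (-β))
    (hLP : ∀ n : ℕ, ‖L ^ n * (1 - P)‖ ≤ D * ((n : ℝ) + 1) ^ (-β)) :
    Tendsto (fun n : ℕ => ‖P ^ n - L ^ (2 * n)‖) atTop (𝓝 0) := by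
  have hD : 0 ≤ D := by simpa using (norm_nonneg _).trans (hP 0)
  have hPL : Commute P L := by
    rw [hL]
    exact (Commute.add_right (Commute.one_right P) (Commute.refl P)).smul_right _
  have hsq : P - L ^ 2 = (-(1 / 4) : ℝ) • ((1 - P) * (1 - P)) := by
    rw [hL, smul_pow]
    have : (1 + P) ^ 2 = (1 - P) * (1 - P) + (4 : ℝ) • P := by
      rw [← Nat.cast_ofNat (R := ℝ), Nat.cast_smul_eq_nsmul]
      noncomm_ring
    rw [this, smul_add, smul_smul]
    norm_num
  have h1P (m : ℕ) : Commute (1 - P) (P ^ m) :=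
    ((Commute.one_left P).sub_left (Commute.refl P)).pow_right m
  have h1L (m : ℕ) : Commute (1 - P) (L ^ m) :=
    ((Commute.one_left L).sub_left hPL).pow_right m
  have hle (n : ℕ) : ‖P ^ n - L ^ (2 * n)‖ ≤ D ^ 2 *
      ∑ i ∈ Finset.range n, (((i : ℝ) + 1) * ((n - 1 - i : ℕ) + 1)) ^ (-β) := by
    rw [pow_mul, ← (hPL.pow_right 2).mul_geom_sum₂, hsq, Finset.mul_sum, Finset.mul_sum]
    refine (norm_sum_le _ _).trans (Finset.sum_le_sum fun i _ => ?_)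
    -- One factor `1 - P` goes to the power of `P`, the other to the power of `L`, so that both
    -- decay.
    have hfac : (-(1 / 4) : ℝ) • ((1 - P) * (1 - P)) * (P ^ i * (L ^ 2) ^ (n - 1 - i)) =
        (-(1 / 4) : ℝ) • ((P ^ i * (1 - P)) * (L ^ (2 * (n - 1 - i)) * (1 - P))) := by
      rw [smul_mul_assoc, ← pow_mul]
      congr 1
      rw [← (h1L _).eq, ← (h1P _).eq, mul_assoc, mul_assoc, ← mul_assoc (1 - P) (P ^ i) (L ^ _),
        (h1P i).eq, mul_assoc]
    rw [hfac, norm_smul, Real.mul_rpow (by positivity) (by positivity)]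
    have h2 := hLP (2 * (n - 1 - i))
    have h3 : (((2 * (n - 1 - i) : ℕ) : ℝ) + 1) ^ (-β) ≤ (((n - 1 - i : ℕ) : ℝ) + 1) ^ (-β) := by
      refine Real.rpow_le_rpow_of_nonpos (by positivity) ?_ (by linarith)
      push_cast
      linarith [Nat.cast_nonneg (α := ℝ) (n - 1 - i)]
    have h4 := (norm_mul_le (P ^ i * (1 - P)) (L ^ (2 * (n - 1 - i)) * (1 - P))).trans
      (mul_le_mul (hP i) (h2.trans (mul_le_mul_of_nonneg_left h3 hD)) (norm_nonneg _)
        (by positivity))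
    have h5 := norm_nonneg ((P ^ i * (1 - P)) * (L ^ (2 * (n - 1 - i)) * (1 - P)))
    norm_num
    nlinarith
  refine squeeze_zero (fun n => norm_nonneg _) hle ?_
  simpa using (tendsto_sum_mul_rpow_neg hβ).const_mul (D ^ 2)

/-! ### Translation-invariant kernels with symmetric decreasing rows. -/

namespace IsStochastic

variable {B : ℤ → ℤ → ℝ}

theorem isSymmDecreasing_matPow (hB : IsStochastic B)
    (ht : ∀ i j t, B (i + t) (j + t) = B i j) (hu : IsSymmDecreasing (B 0)) (n : ℕ) :
    IsSymmDecreasing (matPow B n 0) := by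
  induction n with
  | zero =>
    refine ⟨fun k => by simp [matPow, eq_comm], fun k hk => ?_⟩
    simp only [matPow]
    rw [if_neg (by omega)]
    split_ifs <;> simp
  | succ n ih =>
    have hshift (k j : ℤ) : matPow B n j k = matPow B n 0 (k - j) := by
      rw [← matPow_add_right ht n 0 (k - j) j, zero_add, sub_add_cancel]
    have heq : matPow B (n + 1) 0 = fun k => ∑' j, B 0 j * matPow B n 0 (k - j) := by
      funext k
      exact tsum_congr fun j => by rw [hshift]
    rw [heq]
    refine hu.conv ih fun k => ?_
    refine (summable_matPow_mul hB.nonneg hB.hasSum n 0 k).congr fun j => by rw [hshift]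

theorem op_pow_apply_eq_tsum_shift (hB : IsStochastic B)
    (ht : ∀ i j t, B (i + t) (j + t) = B i j) (n : ℕ) (f : ℤ →ᵇ ℝ) (i : ℤ) :
    HasSum (fun j => matPow B n 0 (j - i) * f j) ((hB.op ^ n) f i) := by
  have h := ((hB.pow n).summable_mul f i).hasSum
  rw [← hB.op_pow_apply] at h
  refine h.congr_fun fun j => ?_
  rw [← matPow_add_right ht n 0 (j - i) i, zero_add, sub_add_cancel]

/-- Rows `i` and `k` of the power are translates by `i - k` of each other, and each unit translation
of a symmetric decreasing row costs at most twice its peak in $\ell^1$. -/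
theorem abs_op_pow_apply_sub_le (hB : IsStochastic B)
    (ht : ∀ i j t, B (i + t) (j + t) = B i j) (hu : IsSymmDecreasing (B 0)) (n : ℕ)
    (f : ℤ →ᵇ ℝ) (i k : ℤ) :
    |(hB.op ^ n) f i - (hB.op ^ n) f k| ≤ 2 * |(i : ℝ) - k| * matPow B n 0 0 * ‖f‖ := by
  have hsum := (hB.pow n).hasSum 0
  obtain ⟨h1, h2⟩ :=
    (hB.isSymmDecreasing_matPow ht hu n).tsum_abs_add_sub_le hsum.summable (i - k)
  have h3 := (hB.op_pow_apply_eq_tsum_shift ht n f i).sub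
    (hB.op_pow_apply_eq_tsum_shift ht n f k)
  have h4 := ((Equiv.subRight i).hasSum_iff.2 h1.hasSum).mul_right ‖f‖
  rw [← h3.tsum_eq, ← Real.norm_eq_abs]
  refine (tsum_of_norm_bounded h4 fun j => ?_).trans ?_
  · simp only [Function.comp, Equiv.subRight_apply]
    rw [← sub_mul, norm_mul, show j - i + (i - k) = j - k by ring, Real.norm_eq_abs (_ - _),
      abs_sub_comm]
    gcongr
    exact f.norm_coe_le_norm j
  · push_cast at h2
    gcongr

end IsStochastic

/-! ### Decay for the lazy long-range kernel. -/

theorem isStochastic_longRange {α : ℝ} (hα : 0 < α) : IsStochastic (longRange α) :=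
  ⟨longRange_nonneg hα, hasSum_longRange hα⟩

theorem longRange_add_right (α : ℝ) (i j t : ℤ) :
    longRange α (i + t) (j + t) = longRange α i j := by
  simp [longRange]

theorem lazy_longRange_add_right (α : ℝ) (i j t : ℤ) :
    lazy (longRange α) (i + t) (j + t) = lazy (longRange α) i j := by
  simp [lazy, longRange_add_right]

theorem normConst_le_one {α : ℝ} (hα : 0 < α) : normConst α ≤ 1 := by
  simpa [longRange] using (isStochastic_longRange hα).le_one 0 1

/-- Laziness matters only at `0`: the diagonal entry `1/2` dominates its neighbour $c(\alpha)/2$. -/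
theorem isSymmDecreasing_lazy_longRange {α : ℝ} (hα : 0 < α) :
    IsSymmDecreasing (lazy (longRange α) 0) where
  neg k := by simp [lazy, longRange, eq_comm]
  succ_le k hk := by
    have hc := normConst_pos hα
    rcases hk.eq_or_lt with rfl | hk
    · have := normConst_le_one hα
      simp [lazy, longRange]
      linarith
    · have h1 : (0 : ℤ) ≠ k + 1 := by omega
      have hk' : (0 : ℝ) < k := by exact_mod_cast hk
      simp only [lazy, longRange, h1, hk.ne, if_false, Int.cast_zero, zero_sub, abs_neg,
        zero_add, Int.cast_add, Int.cast_one, abs_of_pos hk', abs_of_pos (add_pos hk' one_pos)]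
      gcongr
      linarith

theorem longRange_mul_rpow {α γ : ℝ} (hγα : γ < α) (i j : ℤ) :
    longRange α i j * |(i : ℝ) - j| ^ γ =
      normConst α / normConst (α - γ) * longRange (α - γ) i j := by
  have hc := normConst_pos (sub_pos.2 hγα)
  by_cases h : i = j
  · simp [longRange, h]
  · have : (0 : ℝ) < |(i : ℝ) - j| := abs_pos.2 (sub_ne_zero.2 (by exact_mod_cast h))
    simp only [longRange, h, if_false]
    rw [show 1 + α = (1 + (α - γ)) + γ by ring, Real.rpow_add this]
    field_simp

theorem matPow_lazy_longRange_le_rpow {α : ℝ} (hα : 0 < α) :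
    ∃ D, 0 < D ∧ ∀ n : ℕ,
      matPow (lazy (longRange α)) n 0 0 ≤ D * ((n : ℝ) + 1) ^ (-(1 / α)) := by
  set L := lazy (longRange α) with hL
  have hA := isStochastic_longRange hα
  have hS : IsStochastic L := hA.lazy
  have hc := normConst_pos hα
  have hu := hS.isSymmDecreasing_matPow (lazy_longRange_add_right α)
    (isSymmDecreasing_lazy_longRange hα)
  have hrec (n : ℕ) : HasSum (fun j => L 0 j * (matPow L n 0 0 - matPow L n 0 j))
      (matPow L n 0 0 - matPow L (n + 1) 0 0) := by
    have h := ((hS.hasSum 0).mul_right (matPow L n 0 0)).sub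
      (summable_matPow_mul hS.nonneg hS.hasSum n 0 0).hasSum
    rw [one_mul] at h
    refine h.congr_fun fun j => ?_
    have : matPow L n j 0 = matPow L n 0 j := by
      have := matPow_add_right (lazy_longRange_add_right α) n 0 (-j) j
      rw [zero_add, neg_add_cancel] at this
      rw [hL, this, ← hL, (hu n).neg]
    rw [this, mul_sub]
  have hpos : ∀ n, 0 < matPow L n 0 0 := by
    intro n
    induction n with
    | zero => simp [matPow]
    | succ n ih =>
      refine (summable_matPow_mul hS.nonneg hS.hasSum n 0 0).tsum_pos
        (fun k => mul_nonneg (hS.nonneg _ _) ((hS.pow n).nonneg _ _)) 0 (mul_pos ?_ ih)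
      simp [hL, lazy, longRange]
  -- The `4` combines the lazy factor `1/2` with a gap of `x / 2`. The power of two is
  -- $2^{-(1+\alpha)}$ from `j ≤ 2 * K` times $2^{-\alpha}$ from `K ≤ 2 / x`.
  refine le_rpow_of_succ_le_sub (C := normConst α / 4 * 2 ^ (-1 - 2 * α)) hα (by positivity) hpos
    (by simp [matPow]) fun n => ?_
  set x := matPow L n 0 0 with hx
  have hx0 : 0 < x := hpos n
  have hx1 : x ≤ 1 := (hS.pow n).le_one 0 0
  -- At distance at least `1 / x` the entries of the power are at most `x / 2`. The `K` sites of
  -- `[K, 2K)` alone then make the return probability drop by order $K^{-\alpha}x$, that is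
  -- $x^{1+\alpha}$.
  set K := ⌈1 / x⌉₊ with hK
  have hKx : 1 / x ≤ K := Nat.le_ceil _
  have hKx' : (K : ℝ) ≤ 2 / x := by
    have h1 := (Nat.ceil_lt_add_one (by positivity : 0 ≤ 1 / x)).le
    have h2 : 1 ≤ 1 / x := (one_le_div hx0).2 hx1
    rw [show 2 / x = 1 / x + 1 / x by ring]
    linarith
  have hK0 : (0 : ℝ) < K := lt_of_lt_of_le (by positivity) hKx
  have hsum := sum_le_hasSum (Finset.Ico (K : ℤ) (2 * K))
    (fun j _ => mul_nonneg (hS.nonneg 0 j) (sub_nonneg.2 ((hu n).le_zero j))) (hrec n)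
  have hterm : ∀ j ∈ Finset.Ico (K : ℤ) (2 * K),
      normConst α / (2 * K) ^ (1 + α) / 2 * (x / 2) ≤ L 0 j * (x - matPow L n 0 j) := by
    intro j hj
    rw [Finset.mem_Ico] at hj
    have hj1 : (K : ℝ) ≤ j := by exact_mod_cast hj.1
    have hj2 : (j : ℝ) ≤ 2 * K := by exact_mod_cast hj.2.le
    have hj0 : (0 : ℝ) < j := hK0.trans_le hj1
    have hj0' : (0 : ℤ) ≠ j := by
      rintro rfl
      simp at hj0
    refine mul_le_mul ?_ ?_ (by positivity) (hS.nonneg 0 j)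
    · simp only [hL, lazy, longRange, hj0', if_false, Int.cast_zero, zero_sub, abs_neg,
        zero_add, abs_of_pos hj0]
      gcongr
    · have h1 := (hu n).le_inv ((hS.pow n).nonneg 0) ((hS.pow n).hasSum 0) j
      rw [abs_of_pos hj0] at h1
      have h2 : 1 / (2 * (j : ℝ) + 1) ≤ x / 2 := by
        rw [div_le_iff₀ (by positivity)]
        rw [div_le_iff₀ hx0] at hKx
        nlinarith
      linarith
  have hcard := (Finset.card_nsmul_le_sum _ _ _ hterm).trans hsum
  rw [Int.card_Ico, show (2 * (K : ℤ) - K).toNat = K by omega, nsmul_eq_mul] at hcard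
  have hfin : normConst α / 4 * 2 ^ (-1 - 2 * α) * x ^ (1 + α) ≤
      K * (normConst α / (2 * K) ^ (1 + α) / 2 * (x / 2)) := by
    have h1 : (2 / x) ^ (-α) ≤ (K : ℝ) ^ (-α) :=
      Real.rpow_le_rpow_of_nonpos hK0 hKx' (by linarith)
    rw [Real.div_rpow zero_le_two hx0.le, Real.rpow_neg hx0.le, div_inv_eq_mul] at h1
    have h2 : K * (normConst α / (2 * K) ^ (1 + α) / 2 * (x / 2)) =
        normConst α / 4 * 2 ^ (-1 - α) * x * (K : ℝ) ^ (-α) := by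
      rw [Real.mul_rpow zero_le_two hK0.le, Real.rpow_add hK0, Real.rpow_one,
        Real.rpow_neg hK0.le, show -1 - α = -(1 + α) by ring, Real.rpow_neg zero_le_two]
      field_simp
      norm_num
    have h3 : normConst α / 4 * (2 : ℝ) ^ (-1 - 2 * α) * x ^ (1 + α) =
        normConst α / 4 * 2 ^ (-1 - α) * x * (2 ^ (-α) * x ^ α) := by
      rw [Real.rpow_add hx0, Real.rpow_one, show -1 - 2 * α = (-1 - α) + -α by ring,
        Real.rpow_add two_pos]
      ring
    rw [h2, h3]
    gcongr
  linarith

theorem min_one_le_rpow {y γ : ℝ} (hy : 0 ≤ y) (hγ : 0 ≤ γ) (hγ1 : γ ≤ 1) : min 1 y ≤ y ^ γ := by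
  rcases le_total 1 y with h | h
  · exact (min_le_left _ _).trans (Real.one_le_rpow h hγ)
  · exact (min_le_right _ _).trans (Real.self_le_rpow_of_le_one hy h hγ1)

theorem norm_lazy_op_pow_apply_le {α : ℝ} (hα : 0 < α) (f : ℤ →ᵇ ℝ) (n : ℕ) :
    ‖((isStochastic_longRange hα).lazy.op ^ n) f‖ ≤ ‖f‖ := by
  refine (BoundedContinuousFunction.norm_le (norm_nonneg f)).2 fun i => ?_
  rw [IsStochastic.op_pow_apply]
  exact ((isStochastic_longRange hα).lazy.pow n).norm_matAct_le f i

theorem commute_smul_one_add_pow_one_sub {V : Type*} [NormedAddCommGroup V] [NormedSpace ℝ V]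
    (T : V →L[ℝ] V) (c : ℝ) (n : ℕ) : Commute ((c • (1 + T)) ^ n) (1 - T) :=
  ((((Commute.one_left T).add_left (Commute.refl T)).smul_left c).pow_left n) |>
    (Commute.one_right _).sub_right

/-- With $g=L^nf$, the differences $g_i-g_k$ are at most
$2\|f\|\min(1,|i-k|x_n)\le2\|f\|(|i-k|x_n)^\gamma$. Averaging over $A(i,\cdot)$ is possible because
its moment of order $\gamma<\alpha$ is finite. -/
theorem norm_lazy_pow_mul_one_sub_le {α γ : ℝ} (hα : 0 < α) (hγ : 0 < γ) (hγ1 : γ ≤ 1)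
    (hγα : γ < α) : ∃ D, 0 < D ∧ ∀ n : ℕ,
      ‖(isStochastic_longRange hα).lazy.op ^ n * (1 - (isStochastic_longRange hα).op)‖ ≤
        D * ((n : ℝ) + 1) ^ (-(γ / α)) := by
  set hA := isStochastic_longRange hα
  obtain ⟨D, hD, hx⟩ := matPow_lazy_longRange_le_rpow hα
  have hc := normConst_pos hα
  have hc' := normConst_pos (sub_pos.2 hγα)
  set M := normConst α / normConst (α - γ) with hM
  have hM0 : 0 < M := by positivity
  refine ⟨2 * M * D ^ γ, by positivity, fun n => ?_⟩
  have hx0 : 0 ≤ matPow (lazy (longRange α)) n 0 0 := (hA.lazy.pow n).nonneg 0 0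
  have hxγ : matPow (lazy (longRange α)) n 0 0 ^ γ ≤ D ^ γ * ((n : ℝ) + 1) ^ (-(γ / α)) := by
    refine (Real.rpow_le_rpow hx0 (hx n) hγ.le).trans (le_of_eq ?_)
    rw [Real.mul_rpow hD.le (by positivity), ← Real.rpow_mul (by positivity)]
    congr 2
    ring
  refine ContinuousLinearMap.opNorm_le_bound _ (by positivity) fun f => ?_
  have hcomm : Commute (hA.lazy.op ^ n) (1 - hA.op) := by
    rw [hA.op_lazy]
    exact commute_smul_one_add_pow_one_sub _ _ _
  rw [hcomm.eq, mul_apply_eq_comp]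
  set g := (hA.lazy.op ^ n) f with hg
  refine (BoundedContinuousFunction.norm_le (by positivity)).2 fun i => ?_
  have h1 : HasSum (fun k => longRange α i k * (g i - g k)) (g i - hA.op g i) := by
    have h := ((hA.hasSum i).mul_right (g i)).sub (hA.hasSum_op g i)
    rw [one_mul] at h
    exact h.congr_fun fun k => by ring
  have h2 := (((isStochastic_longRange (sub_pos.2 hγα)).hasSum i).mul_left M).mul_right
    (2 * matPow (lazy (longRange α)) n 0 0 ^ γ * ‖f‖)
  rw [mul_one] at h2
  rw [sub_apply, one_apply_eq_self, BoundedContinuousFunction.sub_apply, ← h1.tsum_eq]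
  refine (tsum_of_norm_bounded h2 fun k => ?_).trans ?_
  · rw [← longRange_mul_rpow hγα, norm_mul, Real.norm_of_nonneg (hA.nonneg i k), mul_assoc]
    refine mul_le_mul_of_nonneg_left ?_ (hA.nonneg i k)
    have ha : ‖g i - g k‖ ≤ 2 * ‖f‖ * 1 := by
      have hgf := norm_lazy_op_pow_apply_le hα f n
      have := norm_sub_le (g i) (g k)
      have := g.norm_coe_le_norm i
      have := g.norm_coe_le_norm k
      linarith
    have hb : ‖g i - g k‖ ≤ 2 * ‖f‖ * (|(i : ℝ) - k| * matPow (lazy (longRange α)) n 0 0) := by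
      refine (hA.lazy.abs_op_pow_apply_sub_le (lazy_longRange_add_right α)
        (isSymmDecreasing_lazy_longRange hα) n f i k).trans (le_of_eq ?_)
      ring
    have hmin := le_min ha hb
    rw [← mul_min_of_nonneg _ _ (by positivity : 0 ≤ 2 * ‖f‖)] at hmin
    refine hmin.trans ?_
    have h3 := min_one_le_rpow (mul_nonneg (abs_nonneg ((i : ℝ) - k)) hx0) hγ.le hγ1
    rw [Real.mul_rpow (abs_nonneg _) hx0] at h3
    calc _ ≤ 2 * ‖f‖ * (|(i : ℝ) - k| ^ γ * matPow (lazy (longRange α)) n 0 0 ^ γ) := by gcongr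
      _ = _ := by ring
  · calc _ ≤ M * (2 * (D ^ γ * ((n : ℝ) + 1) ^ (-(γ / α))) * ‖f‖) := by gcongr
      _ = _ := by ring

/-! ### Spatial averages and convergence of the lazy powers. -/

theorem sum_Icc_neg_succ (g : ℤ → ℝ) (n : ℕ) :
    ∑ i ∈ Finset.Icc (-((n + 1 : ℕ) : ℤ)) ((n + 1 : ℕ) : ℤ), g i =
      ∑ i ∈ Finset.Icc (-(n : ℤ)) (n : ℤ), g i + (g (n + 1) + g (-(n + 1))) := by
  have h : Finset.Icc (-((n + 1 : ℕ) : ℤ)) ((n + 1 : ℕ) : ℤ) =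
      insert ((n : ℤ) + 1) (insert (-((n : ℤ) + 1)) (Finset.Icc (-(n : ℤ)) (n : ℤ))) := by
    ext k
    simp only [Finset.mem_Icc, Finset.mem_insert]
    omega
  rw [h, Finset.sum_insert, Finset.sum_insert]
  · ring
  · simp
  · simp only [Finset.mem_insert, Finset.mem_Icc]
    omega

theorem card_Icc_neg (r : ℕ) : ((Finset.Icc (-(r : ℤ)) (r : ℤ)).card : ℝ) = 2 * r + 1 := by
  rw [Int.card_Icc, show ((r : ℤ) + 1 - -r).toNat = 2 * r + 1 by omega]
  push_cast
  ring

namespace IsSymmDecreasing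

variable {u ν : ℤ → ℝ}

theorem abs_sum_mul_le (hu : IsSymmDecreasing u) (h0 : ∀ k, 0 ≤ u k) {ε K : ℝ}
    (hν : ∀ r : ℕ, |∑ i ∈ Finset.Icc (-(r : ℤ)) (r : ℤ), ν i| ≤ ε * (2 * r + 1) + K) (n : ℕ) :
    |∑ i ∈ Finset.Icc (-(n : ℤ)) (n : ℤ), u i * ν i| ≤
      ε * ∑ i ∈ Finset.Icc (-(n : ℤ)) (n : ℤ), u i + K * u 0 := by
  -- Abel summation: with the boundary term subtracted, passing from `n` to `n + 1` adds exactly `u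
  -- n - u (n + 1)` times the sum of `ν` over `|i| ≤ n`.
  have key : |∑ i ∈ Finset.Icc (-(n : ℤ)) (n : ℤ), u i * ν i -
      u n * ∑ i ∈ Finset.Icc (-(n : ℤ)) (n : ℤ), ν i| ≤
      ε * (∑ i ∈ Finset.Icc (-(n : ℤ)) (n : ℤ), u i - u n * (2 * n + 1)) + K * (u 0 - u n) := by
    induction n with
    | zero => simp
    | succ n ih =>
      have h := mul_le_mul_of_nonneg_left (hν n)
        (sub_nonneg.2 (hu.succ_le n (Int.natCast_nonneg n)))
      rw [← abs_of_nonneg (sub_nonneg.2 (hu.succ_le n (Int.natCast_nonneg n))), ← abs_mul,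
        abs_of_nonneg (sub_nonneg.2 (hu.succ_le n (Int.natCast_nonneg n)))] at h
      have h2 := (abs_add_le _ _).trans (add_le_add ih h)
      rw [sum_Icc_neg_succ, sum_Icc_neg_succ, sum_Icc_neg_succ, hu.neg]
      push_cast
      refine (le_of_eq ?_).trans (h2.trans (le_of_eq ?_))
      · congr 1
        ring
      · ring
  have h := mul_le_mul_of_nonneg_left (hν n) (h0 n)
  rw [← abs_of_nonneg (h0 n), ← abs_mul, abs_of_nonneg (h0 n)] at h
  have h2 := (abs_add_le _ _).trans (add_le_add key h)
  rw [sub_add_cancel] at h2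
  linarith

theorem abs_tsum_mul_le (hu : IsSymmDecreasing u) (h0 : ∀ k, 0 ≤ u k) (h1 : HasSum u 1)
    {s ε K : ℝ} (hs : HasSum (fun j => u j * ν j) s)
    (hν : ∀ r : ℕ, |∑ i ∈ Finset.Icc (-(r : ℤ)) (r : ℤ), ν i| ≤ ε * (2 * r + 1) + K) :
    |s| ≤ ε + K * u 0 := by
  have ht : Tendsto (fun n : ℕ => Finset.Icc (-(n : ℤ)) (n : ℤ)) atTop atTop :=
    Finset.tendsto_Icc_neg
  have hlim := ((h1.comp ht).const_mul ε).add_const (K * u 0)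
  rw [mul_one] at hlim
  exact le_of_tendsto_of_tendsto' (hs.comp ht).abs hlim fun n => hu.abs_sum_mul_le h0 hν n

end IsSymmDecreasing

/-- The constant `K` absorbs the finitely many radii at which the mean is not yet within `ε` of its
limit. -/
theorem exists_abs_sum_le_of_isSpatialAverage {μ : ℤ → ℝ} {m b : ℝ} (hm : IsSpatialAverage μ m)
    (hb : ∀ i, |μ i - m| ≤ b) {ε : ℝ} (hε : 0 < ε) :
    ∃ K, ∀ r : ℕ, |∑ i ∈ Finset.Icc (-(r : ℤ)) (r : ℤ), (μ i - m)| ≤ ε * (2 * r + 1) + K := by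
  obtain ⟨R, hR⟩ := Metric.tendsto_atTop.1 hm ε hε
  have hb0 : 0 ≤ b := (abs_nonneg _).trans (hb 0)
  refine ⟨b * (2 * R + 1), fun r => ?_⟩
  rcases le_total R r with h | h
  · have h1 := (hR r h).le
    rw [card_Icc_neg, Real.dist_eq] at h1
    have hr : (0 : ℝ) < 2 * r + 1 := by positivity
    have h2 : ∑ i ∈ Finset.Icc (-(r : ℤ)) (r : ℤ), (μ i - m) =
        ((∑ i ∈ Finset.Icc (-(r : ℤ)) (r : ℤ), μ i) / (2 * r + 1) - m) * (2 * r + 1) := by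
      rw [Finset.sum_sub_distrib, Finset.sum_const, nsmul_eq_mul, card_Icc_neg]
      field_simp
    rw [h2, abs_mul, abs_of_pos hr]
    have : 0 ≤ b * (2 * R + 1) := by positivity
    nlinarith
  · have h1 : |∑ i ∈ Finset.Icc (-(r : ℤ)) (r : ℤ), (μ i - m)| ≤ (2 * r + 1) * b := by
      rw [← card_Icc_neg, ← nsmul_eq_mul]
      exact (Finset.abs_sum_le_sum_abs _ _).trans (Finset.sum_le_card_nsmul _ _ _ fun i _ => hb i)
    have h2 : (r : ℝ) ≤ R := by exact_mod_cast h
    have : 0 ≤ ε * (2 * r + 1) := by positivity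
    nlinarith

theorem tendsto_rpow_neg_natCast_add_one {β : ℝ} (hβ : 0 < β) (C : ℝ) :
    Tendsto (fun n : ℕ => C * ((n : ℝ) + 1) ^ (-β)) atTop (𝓝 0) := by
  have h : Tendsto (fun n : ℕ => (n : ℝ) + 1) atTop atTop :=
    tendsto_atTop_add_const_right _ _ tendsto_natCast_atTop_atTop
  simpa using ((tendsto_rpow_neg_atTop hβ).comp h).const_mul C

theorem tendsto_lazy_op_pow_apply {α : ℝ} (hα : 0 < α) (f : ℤ →ᵇ ℝ) {m : ℝ}
    (hm : IsSpatialAverage f m) (i : ℤ) :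
    Tendsto (fun n => ((isStochastic_longRange hα).lazy.op ^ n) f i) atTop (𝓝 m) := by
  set hS := (isStochastic_longRange hα).lazy
  have ht := lazy_longRange_add_right α
  have hu := isSymmDecreasing_lazy_longRange hα
  have hx : Tendsto (fun n => matPow (lazy (longRange α)) n 0 0) atTop (𝓝 0) := by
    obtain ⟨D, -, hD⟩ := matPow_lazy_longRange_le_rpow hα
    exact squeeze_zero (fun n => (hS.pow n).nonneg 0 0) hD
      (tendsto_rpow_neg_natCast_add_one (one_div_pos.2 hα) D)
  have hshift : Tendsto (fun n => (hS.op ^ n) f i - (hS.op ^ n) f 0) atTop (𝓝 0) := by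
    refine squeeze_zero_norm (fun n => hS.abs_op_pow_apply_sub_le ht hu n f i 0) ?_
    simpa using (hx.const_mul (2 * |(i : ℝ) - (0 : ℤ)|)).mul_const ‖f‖
  have hzero : Tendsto (fun n => (hS.op ^ n) f 0) atTop (𝓝 m) := by
    rw [Metric.tendsto_atTop]
    intro ε hε
    have hb : ∀ i, |f i - m| ≤ ‖f‖ + |m| := fun i =>
      (abs_sub _ _).trans (add_le_add_left (f.norm_coe_le_norm i) _)
    obtain ⟨K, hK⟩ := exists_abs_sum_le_of_isSpatialAverage hm hb (half_pos hε)
    have hlim := (hx.const_mul K).const_add (ε / 2)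
    rw [mul_zero, add_zero] at hlim
    obtain ⟨N, hN⟩ := eventually_atTop.1 (hlim.eventually_lt_const (half_lt_self hε))
    refine ⟨N, fun n hn => ?_⟩
    have h1 := (hS.pow n).hasSum 0
    have h2 := ((hS.pow n).summable_mul f 0).hasSum
    rw [← hS.op_pow_apply] at h2
    have h3 := h2.sub (h1.mul_right m)
    rw [one_mul] at h3
    exact ((hS.isSymmDecreasing_matPow ht hu n).abs_tsum_mul_le ((hS.pow n).nonneg 0) h1
      (h3.congr_fun fun j => by ring) hK).trans_lt (hN n hn)
  simpa using hshift.add hzero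

/-! ### From the lazy kernel back to the original one. -/

theorem matPow_two_longRange_ge {α : ℝ} (hα : 0 < α) (i j : ℤ) :
    normConst α ^ 2 * 2 ^ (-(1 + α)) * lazy (longRange α) i j ≤ matPow (longRange α) 2 i j := by
  have hA := isStochastic_longRange hα
  have hc := normConst_pos hα
  have hc1 := normConst_le_one hα
  have htwo : matPow (longRange α) 2 i j = ∑' k, longRange α i k * longRange α k j := by
    refine tsum_congr fun k => ?_
    congr 1
    exact (tsum_eq_single j fun l hl => by simp [matPow, hl]).trans (by simp [matPow])
  have hs : Summable fun k => longRange α i k * longRange α k j :=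
    (hA.hasSum i).summable.of_nonneg_of_le
      (fun k => mul_nonneg (hA.nonneg _ _) (hA.nonneg _ _))
      fun k => mul_le_of_le_one_right (hA.nonneg _ _) (hA.le_one _ _)
  have hstep (t : ℤ) (h : |t| = 1) :
      normConst α * longRange α (i + t) j ≤ matPow (longRange α) 2 i j := by
    have ht : t ≠ 0 := by rintro rfl; simp at h
    have h' : |(t : ℝ)| = 1 := by exact_mod_cast h
    rw [htwo]
    refine le_trans (le_of_eq ?_) (hs.le_tsum (i + t) fun k _ =>
      mul_nonneg (hA.nonneg _ _) (hA.nonneg _ _))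
    congr 1
    simp [longRange, ht, h']
  have h2 : (2 : ℝ) ^ (-(1 + α)) ≤ 1 :=
    Real.rpow_le_one_of_one_le_of_nonpos one_le_two (by linarith)
  -- A single two-step path suffices: a unit step away from `j`, then a jump to `j`. The
  -- intermediate site is never `j`, and for `i ≠ j` the distance at most doubles.
  obtain ⟨t, ht, htj⟩ : ∃ t : ℤ, |t| = 1 ∧ |i + t - j| = |i - j| + 1 := by
    rcases le_total j i with h | h
    · exact ⟨1, by simp, by rw [abs_of_nonneg, abs_of_nonneg] <;> omega⟩
    · exact ⟨-1, by simp, by rw [abs_of_nonpos, abs_of_nonpos] <;> omega⟩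
  refine le_trans ?_ (hstep t ht)
  have hne : i + t ≠ j := by
    rintro rfl
    have := abs_nonneg (i - (i + t))
    simp at htj
    omega
  have htj' : |((i + t : ℤ) : ℝ) - j| = |(i : ℝ) - j| + 1 := by exact_mod_cast htj
  have hval : longRange α (i + t) j = normConst α / (|(i : ℝ) - j| + 1) ^ (1 + α) := by
    rw [longRange, if_neg hne, htj']
  by_cases hij : i = j
  · rw [hval, hij]
    simp only [lazy, longRange, if_true, sub_self, abs_zero, zero_add, Real.one_rpow, div_one,
      add_zero]
    nlinarith [mul_pos hc hc]
  · have hd : (1 : ℝ) ≤ |(i : ℝ) - j| := by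
      exact_mod_cast Int.one_le_abs (sub_ne_zero.2 hij)
    have h3 : 2 ^ (-(1 + α)) * longRange α i j ≤ longRange α (i + t) j := by
      rw [hval, longRange, if_neg hij, Real.rpow_neg zero_le_two, inv_mul_eq_div, div_div,
        mul_comm, ← Real.mul_rpow zero_le_two (abs_nonneg _)]
      gcongr
      linarith
    have h4 := hA.nonneg i j
    have h5 : normConst α ^ 2 * 2 ^ (-(1 + α)) * lazy (longRange α) i j =
        normConst α * (normConst α * (2 ^ (-(1 + α)) * longRange α i j)) / 2 := by
      simp only [lazy, hij, if_false]
      ring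
    have h6 := hA.nonneg (i + t) j
    rw [h5]
    have h7 : normConst α * (2 ^ (-(1 + α)) * longRange α i j) ≤ longRange α (i + t) j :=
      (mul_le_of_le_one_left (by positivity) hc1).trans h3
    nlinarith [mul_le_mul_of_nonneg_left h7 hc.le, mul_nonneg hc.le h6]

theorem exists_sq_op_longRange_eq {α : ℝ} (hα : 0 < α) :
    ∃ (a b : ℝ) (Q : (ℤ →ᵇ ℝ) →L[ℝ] (ℤ →ᵇ ℝ)), 0 < a ∧ 0 < b ∧ a + b = 1 ∧ ‖Q‖ ≤ 1 ∧
      (isStochastic_longRange hα).op ^ 2 =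
        a • (isStochastic_longRange hα).lazy.op + b • Q := by
  set hA := isStochastic_longRange hα
  set a := normConst α ^ 2 * 2 ^ (-(1 + α)) with ha
  have hc := normConst_pos hα
  have hc1 := normConst_le_one hα
  have ha0 : 0 < a := by positivity
  have ha1 : a < 1 := by
    have h1 : (2 : ℝ) ^ (-(1 + α)) < 1 :=
      Real.rpow_lt_one_of_one_lt_of_neg one_lt_two (by linarith)
    have h2 : normConst α ^ 2 ≤ 1 := pow_le_one₀ hc.le hc1
    exact (mul_le_of_le_one_left (by positivity) h2).trans_lt h1
  have hb : 0 < 1 - a := sub_pos.2 ha1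
  have hQ : IsStochastic fun i j =>
      (matPow (longRange α) 2 i j - a * lazy (longRange α) i j) / (1 - a) :=
    ⟨fun i j => div_nonneg (sub_nonneg.2 (matPow_two_longRange_ge hα i j)) hb.le, fun i => by
      have h := (((hA.pow 2).hasSum i).sub ((hA.lazy.hasSum i).mul_left a)).div_const (1 - a)
      rwa [mul_one, div_self hb.ne'] at h⟩
  refine ⟨a, 1 - a, hQ.op, ha0, hb, by ring, hQ.norm_op_le, ?_⟩
  ext f i
  have h := ((hA.lazy.hasSum_op f i).mul_left a).add ((hQ.hasSum_op f i).mul_left (1 - a))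
  rw [hA.op_pow_apply]
  refine (h.congr_fun fun j => ?_).tsum_eq
  field_simp
  ring

theorem commute_of_sq_eq {V : Type*} [NormedAddCommGroup V] [NormedSpace ℝ V]
    {P L Q : V →L[ℝ] V} {a b : ℝ} (hb : b ≠ 0) (hL : L = (1 / 2 : ℝ) • (1 + P))
    (h : P ^ 2 = a • L + b • Q) : Commute L Q := by
  have hQ : Q = b⁻¹ • (P ^ 2 - a • L) := by
    rw [h, add_sub_cancel_left, smul_smul, inv_mul_cancel₀ hb, one_smul]
  have hLP : Commute L P := by
    rw [hL]
    exact ((Commute.one_left P).add_left (Commute.refl P)).smul_left _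
  rw [hQ]
  exact ((hLP.pow_right 2).sub_right ((Commute.refl L).smul_right a)).smul_right _

theorem opNorm_pow_mul_le {V : Type*} [NormedAddCommGroup V] [NormedSpace ℝ V]
    {P L T : V →L[ℝ] V} {r : ℕ → ℝ} {M D : ℝ} (hMD : 0 ≤ M * D) (hr : ∀ n, 0 ≤ r n)
    (h : ∀ (v : V) (C : ℝ), (∀ k, ‖(L ^ k) v‖ ≤ C * r k) → ∀ n, ‖(P ^ n) v‖ ≤ M * C * r n)
    (hL : ∀ k, ‖L ^ k * T‖ ≤ D * r k) (n : ℕ) : ‖P ^ n * T‖ ≤ M * D * r n := by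
  refine ContinuousLinearMap.opNorm_le_bound _ (mul_nonneg hMD (hr n)) fun f => ?_
  have hv := h (T f) (D * ‖f‖) (fun k => ?_) n
  · rw [mul_apply_eq_comp]
    exact hv.trans (le_of_eq (by ring))
  · rw [← mul_apply_eq_comp]
    exact (ContinuousLinearMap.le_of_opNorm_le _ (hL k) f).trans (le_of_eq (by ring))

/-- Decay along the powers of the lazy operator carries over to the powers of the operator. -/
theorem exists_norm_op_pow_apply_le {α : ℝ} (hα : 0 < α) {β : ℝ} (hβ : 0 ≤ β) (hβ' : β ≤ 1) :
    ∃ M, 0 < M ∧ ∀ (v : ℤ →ᵇ ℝ) (C : ℝ),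
      (∀ k : ℕ, ‖((isStochastic_longRange hα).lazy.op ^ k) v‖ ≤ C * ((k : ℝ) + 1) ^ (-β)) →
      ∀ n : ℕ, ‖((isStochastic_longRange hα).op ^ n) v‖ ≤ M * C * ((n : ℝ) + 1) ^ (-β) := by
  obtain ⟨a, b, Q, ha, hb, hab, hQ, h⟩ := exists_sq_op_longRange_eq hα
  refine ⟨2 / a, by positivity, fun v C hv n => ?_⟩
  have := norm_pow_apply_le_of_sq_eq ha hb.le hab (isStochastic_longRange hα).norm_op_le hQ
    (commute_of_sq_eq hb.ne' (isStochastic_longRange hα).op_lazy h) h hβ hβ' v hv n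
  rwa [div_mul_eq_mul_div]

theorem exists_matPow_longRange_le {α : ℝ} (hα : 0 < α) :
    ∃ β D : ℝ, 0 < β ∧ ∀ (n : ℕ) (i j : ℤ),
      matPow (longRange α) n i j ≤ D * ((n : ℝ) + 1) ^ (-β) := by
  set hA := isStochastic_longRange hα
  -- The exponent is capped at `1`, as the binomial transfer requires.
  have hβ : 0 < min 1 (1 / α) := lt_min one_pos (one_div_pos.2 hα)
  obtain ⟨D, hD, hx⟩ := matPow_lazy_longRange_le_rpow hα
  obtain ⟨M, hM, h⟩ := exists_norm_op_pow_apply_le hα hβ.le (min_le_left _ _)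
  refine ⟨min 1 (1 / α), M * D, hβ, fun n i j => ?_⟩
  rw [← hA.op_pow_basisSeq]
  refine (le_abs_self _).trans (((hA.op ^ n) (basisSeq j)).norm_coe_le_norm i |>.trans
    (h (basisSeq j) D (fun k => ?_) n))
  refine (BoundedContinuousFunction.norm_le (by positivity)).2 fun l => ?_
  rw [hA.lazy.op_pow_basisSeq, Real.norm_of_nonneg ((hA.lazy.pow k).nonneg l j)]
  have h1 := (hA.lazy.isSymmDecreasing_matPow (lazy_longRange_add_right α)
    (isSymmDecreasing_lazy_longRange hα) k).le_zero (j - l)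
  have h2 := matPow_add_right (lazy_longRange_add_right α) k 0 (j - l) l
  rw [zero_add, sub_add_cancel] at h2
  rw [h2]
  refine (h1.trans (hx k)).trans ?_
  gcongr
  · linarith [Nat.cast_nonneg (α := ℝ) k]
  · exact min_le_right _ _

theorem tendsto_norm_op_pow_sub_lazy {α : ℝ} (hα : 0 < α) (hα2 : α < 2) :
    Tendsto (fun n : ℕ => ‖(isStochastic_longRange hα).op ^ n -
      (isStochastic_longRange hα).lazy.op ^ (2 * n)‖) atTop (𝓝 0) := by
  set hA := isStochastic_longRange hα
  -- A choice $\alpha/2<\gamma<\min(1,\alpha)$ exists because $\alpha<2$. It makes the decay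
  -- exponent $\gamma/\alpha$ exceed $1/2$.
  obtain ⟨γ, hγ1, hγ2⟩ :=
    exists_between (lt_min (by linarith : α / 2 < 1) (by linarith : α / 2 < α))
  obtain ⟨hγ1', hγα⟩ := lt_min_iff.1 hγ2
  have hγ : 0 < γ := by linarith
  have hβ : 1 / 2 < γ / α := by rw [lt_div_iff₀ hα]; linarith
  have hβ1 : γ / α ≤ 1 := (div_le_one hα).2 hγα.le
  obtain ⟨D, hD, hL⟩ := norm_lazy_pow_mul_one_sub_le hα hγ hγ1'.le hγα
  obtain ⟨M, hM, h⟩ := exists_norm_op_pow_apply_le hα (by linarith : 0 ≤ γ / α) hβ1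
  have hP (n : ℕ) : ‖hA.op ^ n * (1 - hA.op)‖ ≤ M * D * ((n : ℝ) + 1) ^ (-(γ / α)) :=
    opNorm_pow_mul_le (by positivity) (fun n => by positivity) h hL n
  have hP' (n : ℕ) : ‖hA.op ^ n * (1 - hA.op)‖ ≤
      max (M * D) D * ((n : ℝ) + 1) ^ (-(γ / α)) :=
    (hP n).trans (mul_le_mul_of_nonneg_right (le_max_left _ _) (by positivity))
  have hL' (n : ℕ) : ‖hA.lazy.op ^ n * (1 - hA.op)‖ ≤
      max (M * D) D * ((n : ℝ) + 1) ^ (-(γ / α)) :=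
    (hL n).trans (mul_le_mul_of_nonneg_right (le_max_right _ _) (by positivity))
  exact tendsto_norm_pow_sub_lazy_pow hA.op_lazy hβ hP' hL'

theorem tendsto_op_pow_apply {α : ℝ} (hα : 0 < α) (hα2 : α < 2) (f : ℤ →ᵇ ℝ) {m : ℝ}
    (hm : IsSpatialAverage f m) (i : ℤ) :
    Tendsto (fun n => ((isStochastic_longRange hα).op ^ n) f i) atTop (𝓝 m) := by
  set hA := isStochastic_longRange hα
  have h1 : Tendsto (fun n => (hA.op ^ n) f i - (hA.lazy.op ^ (2 * n)) f i) atTop (𝓝 0) := by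
    refine squeeze_zero_norm (fun n => ?_)
      (by simpa using (tendsto_norm_op_pow_sub_lazy hα hα2).mul_const ‖f‖)
    exact ((hA.op ^ n - hA.lazy.op ^ (2 * n)) f).norm_coe_le_norm i |>.trans
      (ContinuousLinearMap.le_opNorm _ _)
  have h2 := (tendsto_lazy_op_pow_apply hα f hm i).comp
    (tendsto_id.const_mul_atTop' (zero_lt_two' ℕ))
  simpa using h1.add h2

end

theorem lemma3 :
    (∀ α : ℝ, 0 < α →
      (∀ (n : ℕ) (i : ℤ), Summable fun j : ℤ => (matPow (longRange α) n i j) ^ 2) ∧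
      (∀ n : ℕ, BddAbove (Set.range fun i : ℤ => ∑' j : ℤ, (matPow (longRange α) n i j) ^ 2)) ∧
      Tendsto (fun n : ℕ => ⨆ i : ℤ, ∑' j : ℤ, (matPow (longRange α) n i j) ^ 2) atTop (𝓝 0)) ∧
    (∀ α : ℝ, 0 < α → α < 2 →
      ∀ μ : ℤ → ℝ, (∀ i, 0 ≤ μ i) → BddAbove (Set.range μ) →
      ∀ μbar : ℝ, IsSpatialAverage μ μbar →
      ∀ i : ℤ,
        (∀ n : ℕ, Summable fun j : ℤ => matPow (longRange α) n i j * μ j) ∧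
        Tendsto (fun n : ℕ => matAct (matPow (longRange α) n) μ i) atTop (𝓝 μbar)) := by
  refine ⟨fun α hα => ?_, fun α hα hα2 μ hμ0 hμ m hm i => ?_⟩
  · have hA := isStochastic_longRange hα
    obtain ⟨β, D, hβ, hD⟩ := exists_matPow_longRange_le hα
    have hsq (n : ℕ) (i j : ℤ) : matPow (longRange α) n i j ^ 2 ≤
        D * ((n : ℝ) + 1) ^ (-β) * matPow (longRange α) n i j := by
      rw [sq]
      exact mul_le_mul_of_nonneg_right (hD n i j) ((hA.pow n).nonneg i j)
    have hmaj (n : ℕ) (i : ℤ) := ((hA.pow n).hasSum i).mul_left (D * ((n : ℝ) + 1) ^ (-β))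
    have hsum (n : ℕ) (i : ℤ) : Summable fun j : ℤ => matPow (longRange α) n i j ^ 2 :=
      (hmaj n i).summable.of_nonneg_of_le (fun j => sq_nonneg _) (hsq n i)
    have hle (n : ℕ) (i : ℤ) :
        ∑' j : ℤ, matPow (longRange α) n i j ^ 2 ≤ D * ((n : ℝ) + 1) ^ (-β) := by
      simpa using hasSum_le (hsq n i) (hsum n i).hasSum (hmaj n i)
    refine ⟨hsum, fun n => ⟨_, Set.forall_mem_range.2 (hle n)⟩, ?_⟩
    exact squeeze_zero (fun n => Real.iSup_nonneg fun i => tsum_nonneg fun j => sq_nonneg _)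
      (fun n => ciSup_le (hle n)) (tendsto_rpow_neg_natCast_add_one hβ D)
  · have hA := isStochastic_longRange hα
    obtain ⟨b, hb⟩ := hμ
    let f : ℤ →ᵇ ℝ := BoundedContinuousFunction.ofNormedAddCommGroupDiscrete μ b fun i => by
      rw [Real.norm_of_nonneg (hμ0 i)]
      exact hb (Set.mem_range_self i)
    refine ⟨fun n => (hA.pow n).summable_mul f i, ?_⟩
    exact (tendsto_op_pow_apply hα hα2 f hm i).congr fun n => hA.op_pow_apply n f i
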